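/- **Theorem.** For a topological space $Y$ and a finite open cover $\beta$ of $Y$ let $\mathrm{ord}(\beta)=-1+\max_{y\in Y}\#\{U\in\beta : y\in U\}$. The Lebesgue covering dimension is $\dim(Y)=\sup_{\alpha}\min_{\beta}\mathrm{ord}(\beta)$, where $\alpha$ runs over the finite open covers of $Y$ and $\beta$ over the finite open covers of $Y$ that refine $\alpha$ (every element of $\beta$ is contained in some element of $\alpha$); by convention $\dim(\emptyset)=-1$. Let $X$ be a compact metric space with $\dim(X)=d$, where $d\ge 0$ is a finite integer, and let $T:X\to X$ be an injective continuous map. The period of $x\in X$ is the least $p\ge 1$ with $T^p x=x$, if such a $p$ exists, in which case $x$ is called periodic. For $n\ge 1$ let $P_n\subseteq X$ be the set of periodic points of period at most $n$, with the subspace topology, and assume that $\dim(P_n)<\frac{n}{2}$ for all integers $1\le n\le 2d$. Let $C(X,[0,1])$ be the space of continuous functions $h:X\to[0,1]$ with the supremum metric. Then the set of all $h\in C(X,[0,1])$ for which the delay observation map $$X\to[0,1]^{2d+1},\qquad x\mapsto\big(h(x),h(Tx),\ldots,h(T^{2d}x)\big)$$ is a topological embedding is comeagre in $C(X,[0,1])$,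 i.e. its complement is a countable union of nowhere dense sets. -/

import Mathlib

open Set Topology

namespace Takens

/-- A finite open cover of `X`, as a collection of subsets. -/
structure IsFiniteOpenCover {X : Type*} [TopologicalSpace X] (α : Set (Set X)) : Prop where
  finite : α.Finite
  isOpen : ∀ U ∈ α, IsOpen U
  sUnion_eq : ⋃₀ α = Set.univ

/-- `β` refines `α`: every member of `β` is contained in a member of `α`. -/
def Refines {X : Type*} (β α : Set (Set X)) : Prop :=
  ∀ V ∈ β, ∃ U ∈ α, V ⊆ U

/-- The order of a cover: the supremum over the points `x` of the number of members containing `x`,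
minus one. For a cover this number is at least `1`, so the subtraction is not truncated. On the
empty space the order is `⊥`, which plays the role of `-1`. -/
noncomputable def coverOrder {X : Type*} (α : Set (Set X)) : WithBot ℕ∞ :=
  ⨆ x : X, (({U ∈ α | x ∈ U}.encard - 1 : ℕ∞) : WithBot ℕ∞)

/-- The Lebesgue covering dimension: the supremum over all finite open covers `α` of the least order
of a finite open cover refining `α`. The empty space has dimension `⊥`, the role of `-1`. -/
noncomputable def coveringDim (X : Type*) [TopologicalSpace X] : WithBot ℕ∞ :=
  ⨆ (α : Set (Set X)) (_ : IsFiniteOpenCover α),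
    ⨅ (β : Set (Set X)) (_ : IsFiniteOpenCover β ∧ Refines β α), coverOrder β

/-- The set of periodic points of (least) period at most `n`. -/
def periodicPtsLE {X : Type*} (T : X → X) (n : ℕ) : Set X :=
  {x | x ∈ Function.periodicPts T ∧ Function.minimalPeriod T x ≤ n}

/-- The delay observation map `x ↦ (h x, h (T x), …, h (T^(m-1) x))`, with `m` observations. -/
def delayMap {X : Type*} [TopologicalSpace X] (T : X → X) (h : C(X, unitInterval)) (m : ℕ) :
    X → (Fin m → unitInterval) :=
  fun x k => h (T^[(k : ℕ)] x)

end Takens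

/-!
The method is that of Kolmogorov's superposition theorem rather than general position in a nerve.
If a compact space has dimension at most `e`, then for every `N` there are `N` finite families of
small closed sets, each family pairwise disjoint, such that every point lies in the union of all
but at most `e` of the families (`exists_finite_closed_families`). They are obtained from a
partition of unity `ψ` subordinate to a cover of order `e`: the family with index `s` sorts the
points by which coordinates `ψ U` lie above and which lie below a threshold interval. The intervals
are disjoint and lie below `1 / (e + 1)`, and a point is lost for `s` only if some nonzero
coordinate lies in the interval of `s`; not all of its at most `e + 1` nonzero coordinates can, as
they sum to one.

By the Tietze theorem an observable `h` can be moved slightly so as to take distinct constant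
values on finitely many disjoint closed sets of small oscillation. Transporting the families along
the orbits of two points `x ≠ y` and using a different family at each time, one obtains an `h'` near
`h` such that `h' (T^k x') ≠ h' (T^k y')` whenever `x'` near `x` and `y'` near `y` are both covered
by the families in use at time `k` (`exists_perturbation`). If `n` times are available and both
points are lost at fewer than `n / 2` of them, such a `k` exists; this is where `2 * d < 2 * d + 1`
and `2 * dim P_n < n` enter.

Three configurations are distinguished according to the periods of `x` and `y`. If the orbit
segments are disjoint, but `y'` has a smaller period than the number of times available for `x'`,
then `x'` is also compared with itself: equality of the two observation vectors would make the
vector of `x'` periodic (`exists_mem_or_add_mem`). If `y = T^l x` has period at most `4 * d`,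
the families are transported cyclically along the orbit. If `y = T^l x` and there is no such
period, then the points `T^i x` with `i ≤ 2 * d + l` are distinct, and the families are
transported forwards from `y` and backwards as far as `x`; this needs no surjectivity of `T`. So
every pair of distinct points has a neighbourhood, within its pair of period strata, whose points
are separated by an open dense set of observables, and a Lindelöf argument concludes.
-/

namespace Takens

variable {X : Type*}

/-! ### Finite families of small closed sets from the covering dimension -/

/-- The infimum in the covering dimension is attained, so the bound on the dimension yields an
actual refinement of the cover. -/
theorem exists_refinement_of_coveringDim_le {K : Type*} [TopologicalSpace K] {e : ℕ}
    (hK : coveringDim K ≤ e) {α : Set (Set K)} (hα : IsFiniteOpenCover α) :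
    ∃ β : Set (Set K), IsFiniteOpenCover β ∧ Refines β α ∧
      ∀ x : K, {U ∈ β | x ∈ U}.encard ≤ e + 1 := by
  have h1 : (⨅ (β : Set (Set K)) (_ : IsFiniteOpenCover β ∧ Refines β α), coverOrder β)
      < ((e + 1 : ℕ) : WithBot ℕ∞) := by
    refine lt_of_le_of_lt ((le_iSup₂_of_le α hα le_rfl).trans hK) ?_
    exact_mod_cast Nat.lt_succ_self e
  simp only [iInf_lt_iff] at h1
  obtain ⟨β, hβ, hlt⟩ := h1
  refine ⟨β, hβ.1, hβ.2, fun x => ?_⟩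
  have h2 : (({U ∈ β | x ∈ U}.encard - 1 : ℕ∞) : WithBot ℕ∞) < ((e + 1 : ℕ) : WithBot ℕ∞) :=
    lt_of_le_of_lt (le_iSup (fun x : K => (({U ∈ β | x ∈ U}.encard - 1 : ℕ∞) : WithBot ℕ∞)) x) hlt
  have h3 : ({U ∈ β | x ∈ U}.encard - 1 : ℕ∞) < ((e + 1 : ℕ) : ℕ∞) := by exact_mod_cast h2
  have hfin : {U ∈ β | x ∈ U}.Finite := hβ.1.finite.subset (sep_subset _ _)
  rw [hfin.encard_eq_coe_toFinset_card] at h3 ⊢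
  norm_cast at h3 ⊢
  omega

/-- A compact space of dimension at most `e` carries, for any finite number of indices `s`, finite
families `C s` of small disjoint closed sets such that each point `z` is covered by `C s` for all
but at most `e` indices, those in `bad z`. -/
theorem exists_finite_closed_families {K : Type*} [MetricSpace K] [CompactSpace K] {e : ℕ}
    (hK : coveringDim K ≤ e) (S : Type) [Finite S] {δ : ℝ} (hδ : 0 < δ) :
    ∃ (I : Type) (_ : Finite I) (C : S → I → Set K) (bad : K → Finset S),
      (∀ s i, IsClosed (C s i)) ∧ (∀ s, Pairwise (Function.onFun Disjoint (C s))) ∧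
      (∀ s i, ∀ x ∈ C s i, ∀ y ∈ C s i, dist x y < δ) ∧
      (∀ z, (bad z).card ≤ e) ∧ ∀ z, ∀ s ∉ bad z, ∃ i, z ∈ C s i := by
  classical
  -- a finite open cover by small balls
  obtain ⟨t, -, htf, ht⟩ := isCompact_univ.finite_cover_balls (X := K) (half_pos hδ)
  have hα : IsFiniteOpenCover ((fun x => Metric.ball x (δ / 2)) '' t) := by
    refine ⟨htf.image _, ?_, ?_⟩
    · rintro _ ⟨x, -, rfl⟩
      exact Metric.isOpen_ball
    · rw [sUnion_image]
      exact univ_subset_iff.1 ht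
  obtain ⟨β, hβ, href, hord⟩ := exists_refinement_of_coveringDim_le hK hα
  have : Finite β := hβ.finite
  have := Fintype.ofFinite β
  obtain ⟨ψ, hψ⟩ := PartitionOfUnity.exists_isSubordinate_of_locallyFinite (s := univ) isClosed_univ
    (fun U : β => (U : Set K)) (fun U => hβ.isOpen U U.2) (locallyFinite_of_finite _)
    (by rw [← sUnion_eq_iUnion, hβ.sUnion_eq])
  have hsum : ∀ z, ∑ U, ψ U z = 1 := fun z => by
    rw [← finsum_eq_sum_of_fintype]; exact ψ.sum_eq_one (mem_univ z)
  have hmem : ∀ U z, 0 < ψ U z → z ∈ (U : Set K) := fun U z h =>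
    hψ U (subset_tsupport _ (by simpa using h.ne'))
  have hsupp : ∀ z, (Finset.univ.filter fun U => 0 < ψ U z).card ≤ e + 1 := fun z => by
    have h1 := hord z
    have h2 : (((Finset.univ.filter fun U => 0 < ψ U z).map (Function.Embedding.subtype _) :
        Finset (Set K)) : Set (Set K)).encard ≤ e + 1 := by
      refine (encard_le_encard ?_).trans h1
      intro U hU
      simp only [Finset.coe_map, mem_image, Finset.mem_coe, Finset.mem_filter, Finset.mem_univ,
        true_and] at hU
      obtain ⟨V, hV, rfl⟩ := hU
      exact ⟨V.2, hmem V z hV⟩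
    rw [encard_coe_eq_coe_finsetCard, Finset.card_map] at h2
    exact_mod_cast h2
  have hsum' : ∀ z, ∑ U ∈ Finset.univ.filter (fun U => 0 < ψ U z), ψ U z = 1 := fun z => by
    rw [← hsum z, Finset.sum_filter]
    refine Finset.sum_congr rfl fun U _ => ?_
    split_ifs with h
    · rfl
    · exact le_antisymm (ψ.nonneg U z) (not_lt.1 h)
  have hne : ∀ z, (Finset.univ.filter fun U => 0 < ψ U z).Nonempty := fun z => by
    by_contra hne
    have := hsum' z
    rw [Finset.not_nonempty_iff_eq_empty.1 hne] at this
    simp at this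
  set c : ℝ := 1 / (e + 1) with hc
  have hc0 : 0 < c := by positivity
  have hce : (e + 1 : ℝ) * c = 1 := by rw [hc]; field_simp
  -- few coordinates can be positive and below `1 / (e + 1)`, since the coordinates sum to one
  have hlow : ∀ z, (Finset.univ.filter fun U => 0 < ψ U z ∧ ψ U z < c).card ≤ e := fun z => by
    by_contra! hcon
    have hsub : (Finset.univ.filter fun U => 0 < ψ U z ∧ ψ U z < c) ⊆
        Finset.univ.filter fun U => 0 < ψ U z :=
      fun U hU => by simp only [Finset.mem_filter] at hU ⊢; exact ⟨hU.1, hU.2.1⟩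
    have heq := Finset.eq_of_subset_of_card_le hsub ((hsupp z).trans hcon)
    have h1 : ∑ U ∈ Finset.univ.filter (fun U => 0 < ψ U z), ψ U z <
        ∑ U ∈ Finset.univ.filter (fun U => 0 < ψ U z), c := by
      refine Finset.sum_lt_sum_of_nonempty (hne z) fun U hU => ?_
      rw [← heq] at hU
      exact (Finset.mem_filter.1 hU).2.2
    rw [hsum', Finset.sum_const, nsmul_eq_mul] at h1
    have h2 : ((Finset.univ.filter fun U => 0 < ψ U z).card : ℝ) ≤ e + 1 := by
      exact_mod_cast hsupp z
    nlinarith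
  have hbig : ∀ z, ∃ U, c ≤ ψ U z := fun z => by
    by_contra! hcon
    have h1 : ∑ U ∈ Finset.univ.filter (fun U => 0 < ψ U z), ψ U z <
        ∑ U ∈ Finset.univ.filter (fun U => 0 < ψ U z), c :=
      Finset.sum_lt_sum_of_nonempty (hne z) fun U hU => hcon U
    rw [hsum', Finset.sum_const, nsmul_eq_mul] at h1
    have h2 : ((Finset.univ.filter fun U => 0 < ψ U z).card : ℝ) ≤ e + 1 := by
      exact_mod_cast hsupp z
    nlinarith
  -- consecutive disjoint open intervals `(a s, b s)` inside `(0, c)`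
  obtain ⟨N, ⟨idx⟩⟩ := Finite.exists_equiv_fin S
  have := Fintype.ofFinite S
  set a : S → ℝ := fun s => c * (((idx s : ℕ) : ℝ) + 1) / (N + 1) with ha
  set b : S → ℝ := fun s => c * (((idx s : ℕ) : ℝ) + 2) / (N + 1) with hb
  have ha0 : ∀ s, 0 < a s := fun s => by simp only [ha]; positivity
  have hab : ∀ s, a s < b s := fun s => by
    simp only [ha, hb]; gcongr; norm_num
  have hbc : ∀ s, b s ≤ c := fun s => by
    simp only [hb]
    rw [div_le_iff₀ (by positivity)]
    have : ((idx s : ℕ) : ℝ) + 1 ≤ N := by exact_mod_cast (idx s).2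
    nlinarith
  have hint : ∀ s s' (r : ℝ), a s < r → r < b s → a s' < r → r < b s' → s = s' := by
    have key : ∀ s s' (r : ℝ), a s < r → r < b s' → (idx s : ℕ) ≤ idx s' := by
      intro s s' r h1 h2
      by_contra! h3
      have h3' : ((idx s' : ℕ) : ℝ) + 1 ≤ (idx s : ℕ) := by exact_mod_cast h3
      have : b s' ≤ a s := by
        simp only [ha, hb]; gcongr ?_ / _; nlinarith
      linarith
    intro s s' r h1 h2 h3 h4
    exact idx.injective (Fin.ext (le_antisymm (key s s' r h1 h4) (key s' s r h3 h2)))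
  obtain ⟨k, ⟨en⟩⟩ := Finite.exists_equiv_fin (Set β)
  -- the member of the family `s` with index `σ ⊆ β` consists of the points whose coordinates are
  -- at least `b s` on `σ` and at most `a s` off `σ`
  refine ⟨Fin k, inferInstance, fun s i => {z | ∀ U, (U ∈ en.symm i → b s ≤ ψ U z) ∧
    (U ∉ en.symm i → ψ U z ≤ a s)}, fun z => Finset.univ.filter fun s => ∃ U, a s < ψ U z ∧
    ψ U z < b s, ?_, ?_, ?_, ?_, ?_⟩
  · intro s i
    simp only [ofPred_forall, ofPred_and]
    exact isClosed_iInter fun U => ((isClosed_iInter fun _ => isClosed_le continuous_const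
      (ψ U).continuous).inter (isClosed_iInter fun _ => isClosed_le (ψ U).continuous
        continuous_const))
  · intro s i j hij
    refine Set.disjoint_left.2 fun z hi hj => hij (en.symm.injective (Set.ext fun U => ?_))
    have := hab s
    constructor
    · intro h
      by_contra h'
      linarith [(hi U).1 h, (hj U).2 h']
    · intro h
      by_contra h'
      linarith [(hj U).1 h, (hi U).2 h']
  · intro s i x hx y hy
    obtain ⟨U, hU⟩ := hbig x
    have hUi : U ∈ en.symm i := by
      by_contra h
      linarith [(hx U).2 h, hab s, hbc s]
    have h1 := hmem U x (((ha0 s).trans (hab s)).trans_le ((hx U).1 hUi))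
    have h2 := hmem U y (((ha0 s).trans (hab s)).trans_le ((hy U).1 hUi))
    obtain ⟨_, ⟨w, -, rfl⟩, hw⟩ := href U U.2
    have h3 := Metric.mem_ball.1 (hw h1)
    have h4 := Metric.mem_ball.1 (hw h2)
    linarith [dist_triangle_right x y w]
  · intro z
    refine le_trans ?_ (hlow z)
    have : Nonempty β := (hbig z).nonempty
    choose! g hg using fun (s : S) (h : ∃ U, a s < ψ U z ∧ ψ U z < b s) => h
    refine Finset.card_le_card_of_injOn g ?_ ?_
    · intro s hs
      have := hg s (by simpa using hs)
      simpa using ⟨(ha0 s).trans this.1, this.2.trans_le (hbc s)⟩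
    · intro s hs s' hs' hss
      have h1 := hg s (by simpa using hs)
      have h2 := hg s' (by simpa using hs')
      rw [← hss] at h2
      exact hint s s' _ h1.1 h1.2 h2.1 h2.2
  · intro z s hs
    simp only [Finset.mem_filter, Finset.mem_univ, true_and, not_exists, not_and, not_lt] at hs
    refine ⟨en {U | a s < ψ U z}, fun U => ⟨fun h => ?_, fun h => ?_⟩⟩
    · exact hs U (by simpa using h)
    · simpa using h

/-- The consequence of `coveringDim Y ≤ e` that the proof uses, for a subset `Y` of `X`: for each
finite index type `S` and each `δ` there are finite families `C s` of disjoint closed subsets of `X`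
of diameter at most `δ`, and each `z ∈ Y` is covered by `C s` except for the at most `e` indices in
`bad z`. The values of `bad` outside `Y` are irrelevant. -/
def HasSmallFamilies [MetricSpace X] (Y : Set X) (e : ℕ) : Prop :=
  ∀ (S : Type) [Finite S] (δ : ℝ), 0 < δ →
    ∃ (I : Type) (_ : Finite I) (C : S → I → Set X) (bad : X → Finset S),
      (∀ s i, IsClosed (C s i)) ∧ (∀ s, Pairwise (Function.onFun Disjoint (C s))) ∧
      (∀ s i, ∀ x ∈ C s i, ∀ y ∈ C s i, dist x y < δ) ∧
      (∀ z ∈ Y, (bad z).card ≤ e) ∧ ∀ z ∈ Y, ∀ s ∉ bad z, ∃ i, z ∈ C s i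

theorem HasSmallFamilies.of_isometry [MetricSpace X] {K : Type*} [MetricSpace K] [CompactSpace K]
    {e : ℕ} (hK : coveringDim K ≤ e) {f : K → X} (hf : Isometry f) :
    HasSmallFamilies (range f) e := by
  classical
  intro S _ δ hδ
  obtain ⟨I, hI, C, bad, hcl, hdis, hdiam, hcard, hgood⟩ := exists_finite_closed_families hK S hδ
  have hinj := hf.injective
  refine ⟨I, hI, fun s i => f '' C s i,
    fun x => if h : x ∈ range f then bad h.choose else ∅, ?_, ?_, ?_, ?_, ?_⟩
  · exact fun s i => ((hcl s i).isCompact.image hf.continuous).isClosed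
  · exact fun s i j hij => (disjoint_image_iff hinj).2 (hdis s hij)
  · rintro s i _ ⟨x, hx, rfl⟩ _ ⟨y, hy, rfl⟩
    rw [hf.dist_eq]
    exact hdiam s i x hx y hy
  · intro z hz
    simp only [hz, dif_pos]
    exact hcard _
  · intro z hz s hs
    simp only [hz, dif_pos] at hs
    obtain ⟨i, hi⟩ := hgood _ s hs
    exact ⟨i, _, hi, hz.choose_spec⟩

/-! ### Perturbing an observable -/

/-- Finitely many points of the unit interval can be made distinct by a small perturbation: by
Hall's marriage theorem, since balls in the interval are infinite. -/
theorem exists_injective_forall_dist_lt {I : Type*} [Finite I] (v : I → unitInterval) {ε : ℝ}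
    (hε : 0 < ε) : ∃ c : I → unitInterval, Function.Injective c ∧ ∀ i, dist (c i) (v i) < ε := by
  classical
  have := Fintype.ofFinite I
  have hinf : ∀ i, (Metric.ball (v i) ε).Infinite := fun i =>
    infinite_of_mem_nhds (v i) (Metric.ball_mem_nhds _ hε)
  choose t ht hcard using fun i => (hinf i).exists_subset_card_eq (Fintype.card I)
  have hall : ∀ s : Finset I, s.card ≤ (s.biUnion t).card := fun s => by
    rcases s.eq_empty_or_nonempty with rfl | ⟨i, hi⟩
    · simp
    · exact (Finset.card_le_univ s).trans
        ((hcard i).ge.trans (Finset.card_le_card (Finset.subset_biUnion_of_mem t hi)))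
  obtain ⟨c, hc, hct⟩ := (Finset.all_card_le_biUnion_card_iff_exists_injective t).1 hall
  exact ⟨c, hc, fun i => ht i (hct i)⟩

/-- An observable of small oscillation on each of finitely many disjoint closed sets is close to one
that takes distinct constant values on them. -/
theorem exists_dist_lt_forall_eq_const [MetricSpace X] [CompactSpace X] {I : Type*} [Finite I]
    (C : I → Set X) (hC : ∀ i, IsClosed (C i)) (hdis : Pairwise (Function.onFun Disjoint C))
    (h : C(X, unitInterval)) {ε : ℝ} (hε : 0 < ε)
    (hosc : ∀ i, ∀ x ∈ C i, ∀ y ∈ C i, dist (h x) (h y) < ε) :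
    ∃ h' : C(X, unitInterval), dist h' h ≤ 2 * ε ∧
      ∃ c : I → unitInterval, Function.Injective c ∧ ∀ i, ∀ x ∈ C i, h' x = c i := by
  classical
  obtain ⟨c, hcinj, hc⟩ := exists_injective_forall_dist_lt
    (fun i => if hi : (C i).Nonempty then h hi.some else 0) hε
  have hclose : ∀ i, ∀ x ∈ C i, dist (c i) (h x) ≤ 2 * ε := fun i x hx => by
    have hi : (C i).Nonempty := ⟨x, hx⟩
    have h1 := hc i
    rw [dif_pos hi] at h1
    have h2 := hosc i _ hi.some_mem x hx
    linarith [dist_triangle (c i) (h hi.some) (h x)]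
  have : ∀ i, CompactSpace (C i) := fun i => isCompact_iff_compactSpace.1 (hC i).isCompact
  -- the union of the `C i`, as a closed subspace on which the prescribed function is continuous
  let emb : (Σ i, C i) → X := fun p => p.2
  have hemb : IsClosedEmbedding emb := by
    refine Continuous.isClosedEmbedding (continuous_sigma fun i => continuous_subtype_val) ?_
    rintro ⟨i, x, hx⟩ ⟨j, y, hy⟩ hxy
    obtain rfl : x = y := hxy
    obtain rfl : i = j := by
      by_contra hij
      exact Set.disjoint_left.1 (hdis hij) hx hy
    rfl
  let f : C(Σ i, C i, ℝ) := ⟨fun p => (c p.1 : ℝ) - h p.2, continuous_sigma fun i => by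
    simp only; fun_prop⟩
  obtain ⟨g, hg, hgf⟩ := f.exists_extension_forall_mem_of_isClosedEmbedding
    (t := Icc (-(2 * ε)) (2 * ε)) (fun p => abs_le.1 (hclose p.1 p.2 p.2.2))
    ⟨0, by constructor <;> linarith⟩ hemb
  refine ⟨⟨fun x => projIcc 0 1 zero_le_one (h x + g x), by fun_prop⟩, ?_, c, hcinj, ?_⟩
  · refine (ContinuousMap.dist_le (by positivity)).2 fun x => ?_
    have h1 : |(projIcc (0 : ℝ) 1 zero_le_one (h x + g x) : ℝ) -
        projIcc (0 : ℝ) 1 zero_le_one (h x)| ≤ |h x + g x - h x| :=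
      abs_projIcc_sub_projIcc zero_le_one
    rw [projIcc_val, add_sub_cancel_left] at h1
    exact h1.trans (abs_le.2 (hg x))
  · intro i x hx
    have h1 : g x = c i - h x := congrFun hgf ⟨i, x, hx⟩
    simp [h1]

/-- On a compact space `g` depends uniformly continuously on an injective continuous `ρ`, that is,
`g ∘ ρ⁻¹` is uniformly continuous on the range of `ρ`. -/
theorem exists_forall_dist_lt_of_injective [MetricSpace X] [CompactSpace X] {Z : Type*}
    [PseudoMetricSpace Z] {ρ : X → X} (hρ : Continuous ρ) (hρi : Function.Injective ρ) {g : X → Z}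
    (hg : Continuous g) {ε : ℝ} (hε : 0 < ε) :
    ∃ δ > 0, ∀ u v, dist (ρ u) (ρ v) < δ → dist (g u) (g v) < ε := by
  have hcl : IsClosed {p : X × X | ε ≤ dist (g p.1) (g p.2)} :=
    isClosed_le continuous_const (by fun_prop)
  obtain ⟨δ, hδ, h⟩ := hcl.isCompact.exists_forall_le' (f := fun p : X × X => dist (ρ p.1) (ρ p.2))
    (a := 0) (by fun_prop) (by
      rintro ⟨u, v⟩ huv
      refine dist_pos.2 fun h => ?_
      rw [mem_ofPred_eq, hρi h, dist_self] at huv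
      exact hε.not_ge huv)
  exact ⟨δ, hδ, fun u v huv => not_le.1 fun hle => (h (u, v) hle).not_gt huv⟩

/-- The perturbation of an observable at finitely many sites. The site `s` is the compact set
`φ s '' D s`; its points `φ s u` are described by their base point `ρ s u` in a set `Y b` of
dimension at most `e b`, where `b = base s`. The sites being disjoint, some `h'` near `h` takes
different values at points of different sites, unless the base point of one of them is bad for its
site. A single base point is bad for at most `e b` sites, no matter how many sites there are: this
is why sites that are visited by the same point should refer to the same base point. -/
theorem exists_perturbation [MetricSpace X] [CompactSpace X] {S ι : Type} [Finite S]
    {Y : ι → Set X} {e : ι → ℕ} (hY : ∀ b, HasSmallFamilies (Y b) (e b)) (base : S → ι)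
    {D : S → Set X} (hD : ∀ s, IsCompact (D s)) {φ ρ : S → X → X} (hφ : ∀ s, Continuous (φ s))
    (hφi : ∀ s, Function.Injective (φ s)) (hρ : ∀ s, Continuous (ρ s))
    (hρi : ∀ s, Function.Injective (ρ s)) (hDY : ∀ s, MapsTo (ρ s) (D s) (Y (base s)))
    (hdis : Pairwise (Function.onFun Disjoint fun s => φ s '' D s)) (h : C(X, unitInterval))
    {ε : ℝ} (hε : 0 < ε) :
    ∃ h' : C(X, unitInterval), dist h' h < ε ∧ ∃ bad : ι → X → Finset S,
      (∀ b, ∀ z ∈ Y b, (bad b z).card ≤ e b) ∧ ∀ s t, s ≠ t → ∀ u ∈ D s, ∀ v ∈ D t,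
        s ∉ bad (base s) (ρ s u) → t ∉ bad (base t) (ρ t v) → h' (φ s u) ≠ h' (φ t v) := by
  have hε3 : 0 < ε / 3 := by positivity
  choose δ hδ hδh using fun s => exists_forall_dist_lt_of_injective (hρ s) (hρi s)
    (h.continuous.comp (hφ s)) hε3
  obtain ⟨δ₀, hδ₀, hle⟩ : ∃ δ₀ > 0, ∀ s, δ₀ ≤ δ s := by
    rcases isEmpty_or_nonempty S with hS | hS
    · exact ⟨1, one_pos, fun s => isEmptyElim s⟩
    · obtain ⟨s, hs⟩ := Finite.exists_min δ
      exact ⟨δ s, hδ s, hs⟩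
  choose I hI C bad hcl hCdis hdiam hcard hgood using fun b => hY b S δ₀ hδ₀
  have : ∀ b, Finite (I b) := hI
  obtain ⟨h', hh', c, hc, hconst⟩ := exists_dist_lt_forall_eq_const
    (I := Σ s, I (base s)) (fun p => φ p.1 '' (D p.1 ∩ ρ p.1 ⁻¹' C (base p.1) p.1 p.2))
    (fun p => (((hD p.1).inter_right ((hcl _ _ _).preimage (hρ p.1))).image (hφ p.1)).isClosed)
    (by
      rintro ⟨s, i⟩ ⟨t, j⟩ hst
      by_cases hs : s = t
      · subst hs
        have hij : i ≠ j := fun hij => hst (by rw [hij])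
        exact (disjoint_image_iff (hφi s)).2 (((hCdis _ s hij).preimage _).mono
          inter_subset_right inter_subset_right)
      · exact (hdis hs).mono (image_mono inter_subset_left) (image_mono inter_subset_left))
    h hε3 (by
      rintro ⟨s, i⟩ _ ⟨u, hu, rfl⟩ _ ⟨v, hv, rfl⟩
      exact hδh s u v ((hdiam _ _ _ _ hu.2 _ hv.2).trans_le (hle s)))
  refine ⟨h', by linarith, bad, hcard, fun s t hst u hu v hv hus hvt heq => ?_⟩
  obtain ⟨i, hi⟩ := hgood _ _ (hDY s hu) s hus
  obtain ⟨j, hj⟩ := hgood _ _ (hDY t hv) t hvt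
  rw [hconst ⟨s, i⟩ _ ⟨u, ⟨hu, hi⟩, rfl⟩, hconst ⟨t, j⟩ _ ⟨v, ⟨hv, hj⟩, rfl⟩] at heq
  exact hst (congrArg Sigma.fst (hc heq))

/-- The points `x ∈ P` and `y ∈ Q` have compact neighbourhoods `A` and `B`, relative to `P` and `Q`,
such that the observables whose first `w` delays separate all points of `A` from all points of `B`
are dense. -/
def LocallySeparable [MetricSpace X] [CompactSpace X] (T : X → X) (w : ℕ) (P Q : Set X)
    (x y : X) : Prop :=
  ∃ A B : Set X, IsCompact A ∧ IsCompact B ∧ A ∈ 𝓝[P] x ∧ B ∈ 𝓝[Q] y ∧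
    ∀ (h : C(X, unitInterval)) (ε : ℝ), 0 < ε → ∃ h' : C(X, unitInterval), dist h' h < ε ∧
      ∀ x' ∈ A, ∀ y' ∈ B, ∃ k < w, h' (T^[k] x') ≠ h' (T^[k] y')

theorem LocallySeparable.symm [MetricSpace X] [CompactSpace X] {T : X → X} {w : ℕ} {P Q : Set X}
    {x y : X} (H : LocallySeparable T w P Q x y) : LocallySeparable T w Q P y x := by
  obtain ⟨A, B, hA, hB, hAx, hBy, H⟩ := H
  refine ⟨B, A, hB, hA, hBy, hAx, fun h ε hε => ?_⟩
  obtain ⟨h', hd, hs⟩ := H h ε hε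
  refine ⟨h', hd, fun x' hx y' hy => ?_⟩
  obtain ⟨k, hk, hne⟩ := hs y' hy x' hx
  exact ⟨k, hk, hne.symm⟩

/-- Let `G` contain more than half of `{0, …, N - 1}` and `H` more than half of `{0, …, M - 1}`. Then
a member of `G` reduces modulo `M` into `H`, or two members of `G` differ by `M`. It supplies the
time at which an orbit with `N` free observations is told apart from one of period `M ≤ N`. -/
theorem exists_mem_or_add_mem {N M : ℕ} (hMN : M ≤ N) {G H : Finset ℕ} (hG : G ⊆ Finset.range N)
    (hH : H ⊆ Finset.range M) (hGN : N < 2 * G.card) (hHM : M < 2 * H.card) :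
    ∃ k ∈ G, k % M ∈ H ∨ k + M ∈ G := by
  classical
  by_contra! hcon
  -- `k ∈ G` with `M ≤ k` is sent to `k - M`, which lies outside both `G` and `H`
  set L := G.filter (· < M) with hL
  set U := G.filter (¬ · < M) with hU
  have hcard : L.card + U.card = G.card := Finset.card_filter_add_card_filter_not _
  have hLH : L.card + H.card ≤ M := by
    rw [← Finset.card_union_of_disjoint, ← Finset.card_range M]
    · refine Finset.card_le_card (Finset.union_subset (fun k hk => ?_) hH)
      exact Finset.mem_range.2 (Finset.mem_filter.1 hk).2
    · refine Finset.disjoint_left.2 fun k hk hkH => ?_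
      rw [hL, Finset.mem_filter] at hk
      exact (hcon k hk.1).1 (by rwa [Nat.mod_eq_of_lt hk.2])
  have hinj : Set.InjOn (· - M) (U : Set ℕ) := fun a ha b hb hab => by
    simp only [hU, Finset.coe_filter, mem_ofPred_eq] at ha hb hab
    omega
  have hGUH : G.card + (U.card + H.card) ≤ N := by
    have h1 : Disjoint (U.image (· - M)) H := by
      refine Finset.disjoint_left.2 fun k hk hkH => ?_
      obtain ⟨a, ha, rfl⟩ := Finset.mem_image.1 hk
      rw [hU, Finset.mem_filter, not_lt] at ha
      refine (hcon a ha.1).1 ?_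
      have h2 := Finset.mem_range.1 (hH hkH)
      rwa [Nat.mod_eq_sub_mod ha.2, Nat.mod_eq_of_lt h2]
    have h2 : Disjoint G (U.image (· - M) ∪ H) := by
      refine Finset.disjoint_left.2 fun k hkG hk => ?_
      rcases Finset.mem_union.1 hk with hk | hk
      · obtain ⟨a, ha, rfl⟩ := Finset.mem_image.1 hk
        rw [hU, Finset.mem_filter, not_lt] at ha
        refine (hcon _ hkG).2 ?_
        rw [Nat.sub_add_cancel ha.2]
        exact ha.1
      · have h3 := Finset.mem_range.1 (hH hk)
        exact (hcon k hkG).1 (by rwa [Nat.mod_eq_of_lt h3])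
    rw [← Finset.card_image_of_injOn hinj, ← Finset.card_union_of_disjoint h1,
      ← Finset.card_union_of_disjoint h2, ← Finset.card_range N]
    refine Finset.card_le_card (Finset.union_subset hG (Finset.union_subset ?_ ?_))
    · intro k hk
      obtain ⟨a, ha, rfl⟩ := Finset.mem_image.1 hk
      have h3 := Finset.mem_range.1 (hG (Finset.mem_filter.1 ha).1)
      exact Finset.mem_range.2 (by omega)
    · exact hH.trans (Finset.range_mono hMN)
  omega

/-! ### Strata of points by period -/

/-- The points of period exactly `n` if `n ≤ c`; for `n = c + 1`, the points with no period up to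
`c`. For `n` from `1` to `c + 1` these sets partition the space. -/
def orbitStratum (T : X → X) (c n : ℕ) : Set X :=
  {x | (∀ k, 0 < k → k < n → T^[k] x ≠ x) ∧ (n ≤ c → T^[n] x = x)}

theorem exists_mem_orbitStratum (T : X → X) (c : ℕ) (x : X) :
    ∃ n, 0 < n ∧ n ≤ c + 1 ∧ x ∈ orbitStratum T c n := by
  classical
  have h : ∃ n, 0 < n ∧ (n ≤ c → T^[n] x = x) := ⟨c + 1, by omega, fun h => by omega⟩
  have hle : Nat.find h ≤ c + 1 := Nat.find_min' h ⟨by omega, fun h => by omega⟩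
  refine ⟨Nat.find h, (Nat.find_spec h).1, hle, fun k hk hkn heq => ?_, (Nat.find_spec h).2⟩
  exact Nat.find_min h hkn ⟨hk, fun _ => heq⟩

theorem orbitStratum_unique {T : X → X} {c n m : ℕ} (hn : 0 < n) (hm : 0 < m) (hnc : n ≤ c + 1)
    (hmc : m ≤ c + 1) {x : X} (hx : x ∈ orbitStratum T c n) (hx' : x ∈ orbitStratum T c m) :
    n = m := by
  rcases lt_trichotomy n m with h | h | h
  · exact absurd (hx.2 (by omega)) (hx'.1 n hn h)
  · exact h
  · exact absurd (hx'.2 (by omega)) (hx.1 m hm h)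

theorem mapsTo_iterate_orbitStratum {T : X → X} (hTi : Function.Injective T) (c n l : ℕ) :
    MapsTo T^[l] (orbitStratum T c n) (orbitStratum T c n) := by
  intro x hx
  refine ⟨fun k hk hkn heq => hx.1 k hk hkn (hTi.iterate l ?_), fun hn => ?_⟩
  · rwa [← Function.iterate_add_apply, add_comm, Function.iterate_add_apply]
  · rw [← Function.iterate_add_apply, add_comm, Function.iterate_add_apply, hx.2 hn]

theorem iterate_eq_of_iterate_eq {T : X → X} (hTi : Function.Injective T) {x y : X} {i j : ℕ}
    (hij : i ≤ j) (h : T^[i] x = T^[j] y) : x = T^[j - i] y := by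
  refine hTi.iterate i ?_
  rw [h, ← Function.iterate_add_apply, Nat.add_sub_cancel' hij]

theorem eq_of_iterate_eq_of_mem_orbitStratum {T : X → X} (hTi : Function.Injective T)
    {c n : ℕ} {x : X} (hx : x ∈ orbitStratum T c n) {i j : ℕ} (hi : i < n) (hj : j < n)
    (h : T^[i] x = T^[j] x) : i = j := by
  rcases lt_trichotomy i j with hij | hij | hij
  · exact absurd (iterate_eq_of_iterate_eq hTi hij.le h).symm
      (hx.1 (j - i) (by omega) (by omega))
  · exact hij
  · exact absurd (iterate_eq_of_iterate_eq hTi hij.le h.symm).symm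
      (hx.1 (i - j) (by omega) (by omega))

/-- Among `N` times there is one at which neither of two points is lost, if they are lost at fewer
than `N` times altogether. -/
theorem exists_ne_of_card_add_card_lt {S : Type*} {N : ℕ} {f g : Fin N → S}
    (hf : Function.Injective f) (hg : Function.Injective g) {a b : Finset S}
    (hab : a.card + b.card < N) : ∃ k, f k ∉ a ∧ g k ∉ b := by
  classical
  by_contra! hcon
  have h1 : (Finset.univ.filter fun k => f k ∈ a).card ≤ a.card :=
    Finset.card_le_card_of_injOn f (fun k hk => by simpa using hk) hf.injOn
  have h2 : (Finset.univ.filter fun k => ¬ f k ∈ a).card ≤ b.card :=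
    Finset.card_le_card_of_injOn g (fun k hk => hcon k (by simpa using hk)) hg.injOn
  have h3 := Finset.card_filter_add_card_filter_not (s := (Finset.univ : Finset (Fin N)))
    (fun k => f k ∈ a)
  rw [Finset.card_univ, Fintype.card_fin] at h3
  omega

/-- If the points `T^i x` for `i < N` and `T^j y` for `j < M` are distinct, then small neighbourhoods
of `x` and `y` have disjoint images under the same iterates. -/
theorem exists_open_disjoint_iterates [TopologicalSpace X] [T2Space X] {T : X → X}
    (hTc : Continuous T) {N M : ℕ} {x y : X}
    (hinj : Function.Injective
      (Sum.elim (fun i : Fin N => T^[i] x) fun j : Fin M => T^[j] y)) :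
    ∃ U V : Set X, IsOpen U ∧ IsOpen V ∧ x ∈ U ∧ y ∈ V ∧ ∀ A ⊆ U, ∀ B ⊆ V,
      Pairwise (Function.onFun Disjoint
        fun s => (Sum.elim (fun i : Fin N => T^[i]) (fun j : Fin M => T^[j]) s : X → X) ''
          Sum.elim (fun _ => A) (fun _ => B) s) := by
  obtain ⟨W, hW, hWd⟩ := (finite_range
    (Sum.elim (fun i : Fin N => T^[i] x) fun j : Fin M => T^[j] y)).t2_separation
  refine ⟨⋂ i : Fin N, T^[i] ⁻¹' W (T^[i] x), ⋂ j : Fin M, T^[j] ⁻¹' W (T^[j] y),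
    isOpen_iInter_of_finite fun i => (hW _).2.preimage (hTc.iterate i),
    isOpen_iInter_of_finite fun j => (hW _).2.preimage (hTc.iterate j),
    mem_iInter.2 fun i => (hW _).1, mem_iInter.2 fun j => (hW _).1, fun A hA B hB s t hst => ?_⟩
  have key : ∀ s : Fin N ⊕ Fin M,
      (Sum.elim (fun i : Fin N => T^[i]) (fun j : Fin M => T^[j]) s : X → X) ''
        Sum.elim (fun _ => A) (fun _ => B) s ⊆
      W (Sum.elim (fun i : Fin N => T^[i] x) (fun j : Fin M => T^[j] y) s) := by
    rintro (i | j) _ ⟨z, hz, rfl⟩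
    · exact mem_iInter.1 (hA hz) i
    · exact mem_iInter.1 (hB hz) j
  exact (hWd (mem_range_self s) (mem_range_self t) (hinj.ne hst)).mono (key s) (key t)

theorem isClosed_periodicPtsLE [TopologicalSpace X] [T2Space X] {T : X → X}
    (hTc : Continuous T) (n : ℕ) : IsClosed (periodicPtsLE T n) := by
  have h : periodicPtsLE T n = ⋃ k ∈ Finset.Icc 1 n, {x | T^[k] x = x} := by
    ext x
    simp only [periodicPtsLE, mem_ofPred_eq, mem_iUnion, Finset.mem_Icc, exists_prop]
    constructor
    · rintro ⟨hx, hn⟩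
      exact ⟨_, ⟨Function.minimalPeriod_pos_of_mem_periodicPts hx, hn⟩,
        Function.isPeriodicPt_minimalPeriod T x⟩
    · rintro ⟨k, ⟨hk, hkn⟩, hx⟩
      have hx' : Function.IsPeriodicPt T k x := hx
      exact ⟨⟨k, hk, hx'⟩, (hx'.minimalPeriod_le hk).trans hkn⟩
  rw [h]
  exact isClosed_biUnion_finset fun k _ => isClosed_eq (hTc.iterate k) continuous_id

theorem exists_le_of_two_mul_lt {D : WithBot ℕ∞} {n : ℕ} (hn : 0 < n)
    (h : 2 * D < (n : WithBot ℕ∞)) : ∃ e : ℕ, D ≤ e ∧ 2 * e < n := by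
  induction D with
  | bot => exact ⟨0, bot_le, by omega⟩
  | coe D =>
    induction D with
    | top =>
      exfalso
      have : (2 : WithBot ℕ∞) * ((⊤ : ℕ∞) : WithBot ℕ∞) = ((⊤ : ℕ∞) : WithBot ℕ∞) := rfl
      rw [this] at h
      have h2 : (⊤ : ℕ∞) < (n : ℕ∞) := by exact_mod_cast h
      exact not_top_lt h2
    | coe e =>
      have h' : (((2 * e : ℕ) : ℕ∞) : WithBot ℕ∞) < ((n : ℕ∞) : WithBot ℕ∞) := by
        push_cast
        exact h
      exact ⟨e, le_rfl, by exact_mod_cast h'⟩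

/-! ### Local separation of pairs of points -/

section

variable [MetricSpace X] [CompactSpace X] {T : X → X}

/-- The strata are locally compact, being intersections of an open and a closed set. -/
theorem exists_isCompact_subset_orbitStratum (hTc : Continuous T) {c n : ℕ} {x : X}
    (hx : x ∈ orbitStratum T c n) {O : Set X} (hO : IsOpen O) (hxO : x ∈ O) :
    ∃ A, IsCompact A ∧ A ⊆ orbitStratum T c n ∧ A ⊆ O ∧ A ∈ 𝓝[orbitStratum T c n] x := by
  have hopen : IsOpen (O ∩ ⋂ k ∈ Finset.Ioo 0 n, {z | T^[k] z ≠ z}) :=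
    hO.inter (isOpen_biInter_finset fun k _ => isOpen_ne_fun (hTc.iterate k) continuous_id)
  obtain ⟨K, hK, hxK, hKO⟩ := exists_compact_subset hopen (x := x)
    ⟨hxO, by simpa using fun k hk hkn => hx.1 k hk hkn⟩
  have hcl : IsClosed {z | n ≤ c → T^[n] z = z} := by
    by_cases hn : n ≤ c
    · simpa [hn] using isClosed_eq (hTc.iterate n) continuous_id
    · simp [hn]
  refine ⟨K ∩ {z | n ≤ c → T^[n] z = z}, hK.inter_right hcl, fun z hz => ⟨?_, hz.2⟩,
    fun z hz => (hKO hz.1).1, ?_⟩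
  · simpa using (hKO hz.1).2
  · exact Filter.inter_mem (mem_nhdsWithin_of_mem_nhds (mem_interior_iff_mem_nhds.1 hxK))
      (Filter.mem_of_superset self_mem_nhdsWithin fun z hz => hz.2)

/-- Pairs with disjoint orbit segments. The point in the stratum `n` has `min n w` free observations,
each at its own site, and the other one has `min m w` of them. -/
theorem locallySeparable_of_disjoint_orbits (hTc : Continuous T) (hTi : Function.Injective T)
    {w c n m : ℕ} (hwc : w ≤ c + 1) {x y : X}
    (hx : x ∈ orbitStratum T c n) (hy : y ∈ orbitStratum T c m) (hmn : min m w ≤ min n w)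
    (hdis : ∀ i < min n w, ∀ j < min m w, T^[i] x ≠ T^[j] y)
    {Y : Bool → Set X} {e : Bool → ℕ} (hY : ∀ b, HasSmallFamilies (Y b) (e b))
    (hnY : orbitStratum T c n ⊆ Y true) (hmY : orbitStratum T c m ⊆ Y false)
    (hne : 2 * e true < min n w) (hme : 2 * e false < min m w) :
    LocallySeparable T w (orbitStratum T c n) (orbitStratum T c m) x y := by
  classical
  obtain ⟨U, V, hU, hV, hxU, hyV, hUV⟩ := exists_open_disjoint_iterates hTc (N := min n w)
    (M := min m w) (x := x) (y := y) (by
      rintro (i | i) (j | j) hij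
      · exact congrArg _ (Fin.ext (eq_of_iterate_eq_of_mem_orbitStratum hTi hx (by omega)
          (by omega) hij))
      · exact absurd hij (hdis i i.2 j j.2)
      · exact absurd hij.symm (hdis j j.2 i i.2)
      · exact congrArg _ (Fin.ext (eq_of_iterate_eq_of_mem_orbitStratum hTi hy (by omega)
          (by omega) hij)))
  obtain ⟨A, hA, hAn, hAU, hAx⟩ := exists_isCompact_subset_orbitStratum hTc hx hU hxU
  obtain ⟨B, hB, hBm, hBV, hBy⟩ := exists_isCompact_subset_orbitStratum hTc hy hV hyV
  refine ⟨A, B, hA, hB, hAx, hBy, fun h ε hε => ?_⟩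
  obtain ⟨h', hh', bad, hcard, hsep⟩ := exists_perturbation hY
    (Sum.elim (fun _ => true) (fun _ => false) : Fin (min n w) ⊕ Fin (min m w) → Bool)
    (D := Sum.elim (fun _ => A) (fun _ => B))
    (φ := Sum.elim (fun i : Fin (min n w) => T^[i]) (fun j : Fin (min m w) => T^[j]))
    (ρ := fun _ => id)
    (by rintro (i | j); exacts [hA, hB])
    (by rintro (i | j); exacts [hTc.iterate i, hTc.iterate j])
    (by rintro (i | j); exacts [hTi.iterate i, hTi.iterate j])
    (fun _ => continuous_id) (fun _ => Function.injective_id)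
    (by rintro (i | j); exacts [fun z hz => hnY (hAn hz), fun z hz => hmY (hBm hz)])
    (hUV A hAU B hBV) h hε
  refine ⟨h', hh', fun x' hx' y' hy' => ?_⟩
  by_contra! hcon
  -- `y'` is periodic of period `m` as soon as it has fewer coordinates than `x'`
  have hper : min m w < min n w → Function.IsPeriodicPt T (min m w) y' := fun hlt => by
    have hmw : min m w = m := by omega
    rw [hmw]
    exact (hBm hy').2 (by omega)
  let q : Fin (min n w) ⊕ Fin (min m w) → ℕ := Sum.elim Fin.val Fin.val
  have hqcard : ∀ b, ∀ z ∈ Y b, ((bad b z).image q).card ≤ e b := fun b z hz =>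
    Finset.card_image_le.trans (hcard b z hz)
  have hG := Finset.le_card_sdiff ((bad true x').image q) (Finset.range (min n w))
  have hH := Finset.le_card_sdiff ((bad false y').image q) (Finset.range (min m w))
  have hqx := hqcard true x' (hnY (hAn hx'))
  have hqy := hqcard false y' (hmY (hBm hy'))
  rw [Finset.card_range] at hG hH
  have hGmem : ∀ k ∈ Finset.range (min n w) \ (bad true x').image q, ∃ hk : k < min n w,
      (Sum.inl ⟨k, hk⟩ : Fin (min n w) ⊕ Fin (min m w)) ∉ bad true x' := fun k hk => by
    rw [Finset.mem_sdiff, Finset.mem_range] at hk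
    exact ⟨hk.1, fun hb => hk.2 (Finset.mem_image.2 ⟨_, hb, rfl⟩)⟩
  have hHmem : ∀ k ∈ Finset.range (min m w) \ (bad false y').image q, ∃ hk : k < min m w,
      (Sum.inr ⟨k, hk⟩ : Fin (min n w) ⊕ Fin (min m w)) ∉ bad false y' := fun k hk => by
    rw [Finset.mem_sdiff, Finset.mem_range] at hk
    exact ⟨hk.1, fun hb => hk.2 (Finset.mem_image.2 ⟨_, hb, rfl⟩)⟩
  obtain ⟨k, hkG, hk⟩ := exists_mem_or_add_mem hmn Finset.sdiff_subset
    Finset.sdiff_subset (by omega) (by omega) (G := Finset.range (min n w) \ (bad true x').image q)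
    (H := Finset.range (min m w) \ (bad false y').image q)
  obtain ⟨hkn, hkb⟩ := hGmem k hkG
  rcases hk with hk | hk
  · obtain ⟨hkm, hkb'⟩ := hHmem _ hk
    refine hsep (Sum.inl ⟨k, hkn⟩) (Sum.inr ⟨_, hkm⟩) Sum.inl_ne_inr x' hx' y' hy' hkb hkb' ?_
    have h1 : T^[k % min m w] y' = T^[k] y' := by
      rcases hmn.lt_or_eq with hlt | heq
      · exact (hper hlt).iterate_mod_apply k
      · rw [Nat.mod_eq_of_lt (heq ▸ hkn)]
    exact (hcon k (by omega)).trans (congrArg h' h1.symm)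
  · obtain ⟨hkm, hkb'⟩ := hGmem _ hk
    refine hsep (Sum.inl ⟨k, hkn⟩) (Sum.inl ⟨_, hkm⟩)
      (fun h => by have := congrArg q h; simp only [q, Sum.elim_inl] at this; omega)
      x' hx' x' hx' hkb hkb' ?_
    have h1 : T^[k + min m w] y' = T^[k] y' := by
      rw [Function.iterate_add_apply, (hper (by omega)).eq]
    exact (hcon k (by omega)).trans ((congrArg h' h1.symm).trans (hcon _ (by omega)).symm)

/-- Two points of the same periodic orbit. All points near them within the stratum are described by
base points near `x`, and the `n` sites are arranged cyclically. The period may exceed `w`. -/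
theorem locallySeparable_iterate_of_periodic (hTc : Continuous T) (hTi : Function.Injective T)
    {w c n l : ℕ} (hnc : n ≤ c) (hl : 0 < l) (hln : l < n) {x : X} (hx : x ∈ orbitStratum T c n)
    {Y : Set X} {e : ℕ} (hY : HasSmallFamilies Y e) (hnY : orbitStratum T c n ⊆ Y)
    (hne : 2 * e < min n w) :
    LocallySeparable T w (orbitStratum T c n) (orbitStratum T c n) x (T^[l] x) := by
  obtain ⟨U, V, hU, hV, hxU, hyV, hUV⟩ := exists_open_disjoint_iterates hTc (N := n)
    (M := 0) (x := x) (y := x) (by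
      rintro (i | i) (j | j) hij
      · exact congrArg _ (Fin.ext (eq_of_iterate_eq_of_mem_orbitStratum hTi hx i.2 j.2 hij))
      · exact j.elim0
      · exact i.elim0
      · exact i.elim0)
  obtain ⟨A, hA, hAn, hAU, hAx⟩ := exists_isCompact_subset_orbitStratum hTc hx hU hxU
  obtain ⟨B, hB, hBn, -, hBy⟩ := exists_isCompact_subset_orbitStratum hTc
    (mapsTo_iterate_orbitStratum hTi c n l hx) isOpen_univ (mem_univ _)
  -- `T^[n - l]` inverts `T^[l]` on the stratum and brings points near `T^[l] x` back to `A`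
  have hback : T^[n - l] (T^[l] x) = x := by
    rw [← Function.iterate_add_apply, Nat.sub_add_cancel hln.le, hx.2 hnc]
  have htend : Filter.Tendsto T^[n - l] (𝓝[orbitStratum T c n] (T^[l] x))
      (𝓝[orbitStratum T c n] x) := by
    have h1 := (hTc.iterate (n - l)).continuousWithinAt.tendsto_nhdsWithin
      (mapsTo_iterate_orbitStratum hTi c n (n - l)) (x := T^[l] x)
    rwa [hback] at h1
  refine ⟨A, B ∩ T^[n - l] ⁻¹' A, hA, hB.inter_right (hA.isClosed.preimage (hTc.iterate _)), hAx,
    Filter.inter_mem hBy (htend hAx), fun h ε hε => ?_⟩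
  obtain ⟨h', hh', bad, hcard, hsep⟩ := exists_perturbation (fun _ : Unit => hY)
    (fun _ : Fin n => ()) (D := fun _ => A) (φ := fun i => T^[i]) (ρ := fun _ => id)
    (fun _ => hA) (fun i => hTc.iterate i) (fun i => hTi.iterate i)
    (fun _ => continuous_id) (fun _ => Function.injective_id) (fun _ z hz => hnY (hAn hz))
    (fun i j hij => hUV A hAU ∅ (empty_subset _) (Sum.inl_injective.ne hij)) h hε
  refine ⟨h', hh', fun x' hx' y' hy' => ?_⟩
  have h1 := hcard () x' (hnY (hAn hx'))
  have h2 := hcard () _ (hnY (hAn hy'.2))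
  have hshift : Function.Injective fun k : Fin (min n w) =>
      (⟨(k + l) % n, Nat.mod_lt _ (by omega)⟩ : Fin n) := fun k k' hkk => by
    have h3 : k + l ≡ k' + l [MOD n] := congrArg Fin.val hkk
    exact Fin.ext ((Nat.ModEq.add_right_cancel' l h3).eq_of_lt_of_lt (by omega) (by omega))
  obtain ⟨k, hk, hk'⟩ := exists_ne_of_card_add_card_lt
    (f := Fin.castLE (min_le_left n w)) (Fin.castLE_injective _) hshift
    (a := bad () x') (b := bad () (T^[n - l] y')) (by omega)
  have hkn : (k : ℕ) < n := by omega
  refine ⟨k, by omega, ?_⟩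
  have hper : Function.IsPeriodicPt T n (T^[n - l] y') := (hAn hy'.2).2 hnc
  have h3 : T^[(k + l) % n] (T^[n - l] y') = T^[k] y' := by
    rw [hper.iterate_mod_apply, ← Function.iterate_add_apply,
      show (k : ℕ) + l + (n - l) = k + n by omega, Function.iterate_add_apply, (hBn hy'.1).2 hnc]
  rw [← h3]
  refine hsep _ ⟨_, Nat.mod_lt _ (by omega)⟩ (fun heq => ?_) x' hx' _ hy'.2 hk hk'
  have h4 : (k : ℕ) + 0 ≡ k + l [MOD n] := by
    rw [add_zero]
    exact (Nat.mod_eq_of_lt hkn).trans (congrArg Fin.val heq)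
  have h5 := (Nat.ModEq.add_left_cancel' _ h4).eq_of_lt_of_lt (by omega) hln
  omega

/-- Two points of the same orbit with at least `w + l` distinct consecutive iterates. All points
involved are described by base points near `T^[l] x`: the first `l` sites lie backwards from there
and the other `w` forwards. Points near `T^[l] x` need not have preimages, but they only visit the
forward sites. -/
theorem locallySeparable_iterate_of_long_orbit (hTc : Continuous T) (hTi : Function.Injective T)
    {w c n l : ℕ} (hl : 0 < l) (hln : w + l ≤ n) {x : X}
    (hx : x ∈ orbitStratum T c n)
    {Y : Set X} {e : ℕ} (hY : HasSmallFamilies Y e) (hnY : orbitStratum T c n ⊆ Y)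
    (hne : 2 * e < w) :
    LocallySeparable T w (orbitStratum T c n) (orbitStratum T c n) x (T^[l] x) := by
  obtain ⟨U, V, hU, hV, hxU, hyV, hUV⟩ := exists_open_disjoint_iterates hTc (N := l)
    (M := w) (x := x) (y := T^[l] x) (by
      rintro (i | i) (j | j) hij <;>
        simp only [Sum.elim_inl, Sum.elim_inr, ← Function.iterate_add_apply] at hij <;>
        have h1 := eq_of_iterate_eq_of_mem_orbitStratum hTi hx (by omega) (by omega) hij
      · exact congrArg _ (Fin.ext h1)
      · omega
      · omega
      · exact congrArg _ (Fin.ext (by omega)))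
  obtain ⟨B, hB, hBn, hBV, hBy⟩ := exists_isCompact_subset_orbitStratum hTc
    (mapsTo_iterate_orbitStratum hTi c n l hx) hV hyV
  obtain ⟨A, hA, hAn, hAU, hAx⟩ := exists_isCompact_subset_orbitStratum hTc hx hU hxU
  have htend : Filter.Tendsto T^[l] (𝓝[orbitStratum T c n] x) (𝓝[orbitStratum T c n] (T^[l] x)) :=
    (hTc.iterate l).continuousWithinAt.tendsto_nhdsWithin (mapsTo_iterate_orbitStratum hTi c n l)
  have hA' : IsCompact (A ∩ T^[l] ⁻¹' B) := hA.inter_right (hB.isClosed.preimage (hTc.iterate _))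
  refine ⟨A ∩ T^[l] ⁻¹' B, B, hA', hB, Filter.inter_mem hAx (htend hBy), hBy, fun h ε hε => ?_⟩
  obtain ⟨h', hh', bad, hcard, hsep⟩ := exists_perturbation (fun _ : Unit => hY)
    (fun _ : Fin l ⊕ Fin w => ())
    (D := Sum.elim (fun _ => A ∩ T^[l] ⁻¹' B) (fun _ => B))
    (φ := Sum.elim (fun i : Fin l => T^[i]) (fun j : Fin w => T^[j]))
    (ρ := Sum.elim (fun _ => T^[l]) (fun _ => id))
    (by rintro (i | j); exacts [hA', hB])
    (by rintro (i | j); exacts [hTc.iterate i, hTc.iterate j])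
    (by rintro (i | j); exacts [hTi.iterate i, hTi.iterate j])
    (by rintro (i | j); exacts [hTc.iterate l, continuous_id])
    (by rintro (i | j); exacts [hTi.iterate l, Function.injective_id])
    (by rintro (i | j); exacts [fun z hz => hnY (hBn hz.2), fun z hz => hnY (hBn hz)])
    (hUV _ (inter_subset_left.trans hAU) B hBV) h hε
  refine ⟨h', hh', fun x' hx' y' hy' => ?_⟩
  have h1 := hcard () _ (hnY (hBn hx'.2))
  have h2 := hcard () y' (hnY (hBn hy'))
  let f : Fin w → Fin l ⊕ Fin w := fun k =>
    if hk : (k : ℕ) < l then Sum.inl ⟨k, hk⟩ else Sum.inr ⟨k - l, by omega⟩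
  have hf : Function.Injective f := fun k k' hkk => by
    simp only [f] at hkk
    split_ifs at hkk <;> simp only [Sum.inl.injEq, Sum.inr.injEq, Fin.mk.injEq] at hkk <;> omega
  obtain ⟨k, hk, hk'⟩ := exists_ne_of_card_add_card_lt hf
    (Sum.inr_injective (α := Fin l) (β := Fin w))
    (a := bad () (T^[l] x')) (b := bad () y') (by omega)
  refine ⟨k, k.2, ?_⟩
  by_cases hkl : (k : ℕ) < l
  · simp only [f, hkl, dif_pos] at hk
    exact hsep (Sum.inl ⟨k, hkl⟩) (Sum.inr k) Sum.inl_ne_inr x' hx' y' hy' hk hk'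
  · simp only [f, hkl, dif_neg, not_false_eq_true] at hk
    have h3 := hsep (Sum.inr ⟨k - l, by omega⟩) (Sum.inr k)
      (fun h => by have := congrArg Fin.val (Sum.inr_injective h); simp only at this; omega)
      (T^[l] x') hx'.2 y' hy' hk hk'
    simp only [Sum.elim_inr] at h3
    rwa [← Function.iterate_add_apply, Nat.sub_add_cancel (not_lt.1 hkl)] at h3

/-- The bound `c = 2 * (w - 1)` is what makes the three configurations exhaustive: in the absence of
periods up to `c`, the segment formed by two overlapping windows of length `w` has no repetition. -/
theorem locallySeparable_of_ne (hTc : Continuous T) (hTi : Function.Injective T) {w c n m : ℕ}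
    (hwc : c + 2 = 2 * w)
    (hY : ∀ n, 0 < n → ∃ Y e, HasSmallFamilies Y e ∧ orbitStratum T c n ⊆ Y ∧ 2 * e < min n w)
    (hn : 0 < n) (hm : 0 < m) (hnc : n ≤ c + 1) (hmc : m ≤ c + 1) {x y : X}
    (hx : x ∈ orbitStratum T c n) (hy : y ∈ orbitStratum T c m) (hxy : x ≠ y) :
    LocallySeparable T w (orbitStratum T c n) (orbitStratum T c m) x y := by
  have key : ∀ {n m : ℕ} {x y : X}, 0 < n → 0 < m → n ≤ c + 1 → m ≤ c + 1 →
      x ∈ orbitStratum T c n → y ∈ orbitStratum T c m → x ≠ y → ∀ l < min n w, y = T^[l] x →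
      LocallySeparable T w (orbitStratum T c n) (orbitStratum T c m) x y := by
    intro n m x y hn hm hnc hmc hx hy hxy l hl hyl
    have hl0 : 0 < l := Nat.pos_of_ne_zero fun h => hxy (by rw [hyl, h]; rfl)
    subst hyl
    obtain rfl : n = m :=
      orbitStratum_unique hn hm hnc hmc (mapsTo_iterate_orbitStratum hTi c n l hx) hy
    obtain ⟨Y, e, hYe, hYn, he⟩ := hY n hn
    rcases hnc.lt_or_eq with hlt | heq
    · exact locallySeparable_iterate_of_periodic hTc hTi (by omega) hl0 (by omega) hx hYe hYn he
    · exact locallySeparable_iterate_of_long_orbit hTc hTi hl0 (by omega) hx hYe hYn (by omega)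
  by_cases hdis : ∀ i < min n w, ∀ j < min m w, T^[i] x ≠ T^[j] y
  · wlog hmn : min m w ≤ min n w generalizing n m x y
    · exact (this hm hn hmc hnc hy hx hxy.symm (fun i hi j hj h => hdis j hj i hi h.symm)
        (by omega)).symm
    obtain ⟨Y₁, e₁, hY₁, hYn, he₁⟩ := hY n hn
    obtain ⟨Y₂, e₂, hY₂, hYm, he₂⟩ := hY m hm
    exact locallySeparable_of_disjoint_orbits hTc hTi (by omega) hx hy hmn hdis
      (Y := fun b => cond b Y₁ Y₂) (e := fun b => cond b e₁ e₂)
      (by rintro (_ | _); exacts [hY₂, hY₁]) hYn hYm he₁ he₂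
  · push Not at hdis
    obtain ⟨i, hi, j, hj, hij⟩ := hdis
    rcases le_total i j with hle | hle
    · exact (key hm hn hmc hnc hy hx hxy.symm (j - i) (by omega)
        (iterate_eq_of_iterate_eq hTi hle hij)).symm
    · exact key hn hm hnc hmc hx hy hxy (i - j) (by omega)
        (iterate_eq_of_iterate_eq hTi hle hij.symm)

/-- The dimension hypotheses: a stratum of period `n ≤ 2 * d` is contained in `P_n`, and every
other stratum in the whole space, on which all `2 * d + 1` observations are free. -/
theorem exists_hasSmallFamilies (hTc : Continuous T) {d : ℕ} (hd : coveringDim X = (d : WithBot ℕ∞))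
    (hP : ∀ n : ℕ, 1 ≤ n → n ≤ 2 * d →
      2 * coveringDim (periodicPtsLE T n) < (n : WithBot ℕ∞)) {n : ℕ} (hn : 0 < n) :
    ∃ Y e, HasSmallFamilies Y e ∧ orbitStratum T (4 * d) n ⊆ Y ∧ 2 * e < min n (2 * d + 1) := by
  by_cases hnd : n ≤ 2 * d
  · obtain ⟨e, he, hen⟩ := exists_le_of_two_mul_lt hn (hP n hn hnd)
    have : CompactSpace (periodicPtsLE T n) :=
      isCompact_iff_compactSpace.1 (isClosed_periodicPtsLE hTc n).isCompact
    refine ⟨_, e, HasSmallFamilies.of_isometry he isometry_subtype_coe, ?_, by omega⟩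
    rw [Subtype.range_coe]
    intro x hx
    have hx' : Function.IsPeriodicPt T n x := hx.2 (by omega)
    exact ⟨⟨n, hn, hx'⟩, hx'.minimalPeriod_le hn⟩
  · exact ⟨_, d, HasSmallFamilies.of_isometry hd.le isometry_id, by simp, by omega⟩

/-- Separation of two disjoint compact sets is an open condition on the observable, so local
separability makes it generic. -/
theorem LocallySeparable.eventually_residual {w : ℕ} (hTc : Continuous T) {P Q : Set X} {x y : X}
    (H : LocallySeparable T w P Q x y) : ∃ W ∈ 𝓝[P ×ˢ Q] (x, y),
      ∀ᶠ h in residual C(X, unitInterval), ∀ p ∈ W, delayMap T h w p.1 ≠ delayMap T h w p.2 := by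
  obtain ⟨A, B, hA, hB, hAx, hBy, H⟩ := H
  refine ⟨A ×ˢ B, by rw [nhdsWithin_prod_eq]; exact Filter.prod_mem_prod hAx hBy, ?_⟩
  refine residual_of_dense_open ?_ ?_
  · refine isOpen_iff_eventually.2 fun h hh =>
      (hA.prod hB).eventually_forall_of_forall_eventually fun p hp => ?_
    have hcont : ∀ g : X × X → X, Continuous g →
        Continuous fun z : C(X, unitInterval) × (X × X) => delayMap T z.1 w (g z.2) :=
      fun g hg => continuous_pi fun k =>
        continuous_eval.comp (continuous_fst.prodMk ((hTc.iterate k).comp (hg.comp continuous_snd)))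
    exact (isOpen_ne_fun (hcont _ continuous_fst) (hcont _ continuous_snd)).mem_nhds (hh p hp)
  · refine Metric.dense_iff.2 fun h ε hε => ?_
    obtain ⟨h', hh', hs⟩ := H h ε hε
    refine ⟨h', hh', fun p hp heq => ?_⟩
    obtain ⟨k, hk, hne⟩ := hs p.1 hp.1 p.2 hp.2
    exact hne (congrFun heq ⟨k, hk⟩)

/-- Genericity of injectivity: within each pair of strata, countably many of the neighbourhoods
from `locallySeparable_of_ne` cover the pairs of distinct points. -/
theorem eventually_residual_injective (hTc : Continuous T) (hTi : Function.Injective T) {d : ℕ}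
    (hd : coveringDim X = (d : WithBot ℕ∞))
    (hP : ∀ n : ℕ, 1 ≤ n → n ≤ 2 * d →
      2 * coveringDim (periodicPtsLE T n) < (n : WithBot ℕ∞)) :
    ∀ᶠ h in residual C(X, unitInterval), Function.Injective (delayMap T h (2 * d + 1)) := by
  have key : ∀ n m : ℕ, ∀ᶠ h in residual C(X, unitInterval),
      ∀ p ∈ {p : X × X | 0 < n ∧ n ≤ 4 * d + 1 ∧ 0 < m ∧ m ≤ 4 * d + 1 ∧
        p.1 ∈ orbitStratum T (4 * d) n ∧ p.2 ∈ orbitStratum T (4 * d) m ∧ p.1 ≠ p.2},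
      delayMap T h (2 * d + 1) p.1 ≠ delayMap T h (2 * d + 1) p.2 := by
    intro n m
    set E := {p : X × X | 0 < n ∧ n ≤ 4 * d + 1 ∧ 0 < m ∧ m ≤ 4 * d + 1 ∧
        p.1 ∈ orbitStratum T (4 * d) n ∧ p.2 ∈ orbitStratum T (4 * d) m ∧ p.1 ≠ p.2} with hE
    have hex : ∀ p ∈ E, ∃ W ∈ 𝓝[E] p, ∀ᶠ h in residual C(X, unitInterval),
        ∀ q ∈ W, delayMap T h (2 * d + 1) q.1 ≠ delayMap T h (2 * d + 1) q.2 := by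
      rintro ⟨x, y⟩ ⟨hn, hnd, hm, hmd, hx, hy, hxy⟩
      obtain ⟨W, hW, hres⟩ := (locallySeparable_of_ne hTc hTi (w := 2 * d + 1) (by omega)
        (fun k hk => exists_hasSmallFamilies hTc hd hP hk) hn hm hnd hmd hx hy
        hxy).eventually_residual hTc
      have hsub : E ⊆ orbitStratum T (4 * d) n ×ˢ orbitStratum T (4 * d) m :=
        fun p hp => ⟨hp.2.2.2.2.1, hp.2.2.2.2.2.1⟩
      exact ⟨W, nhdsWithin_mono _ hsub hW, hres⟩
    choose! W hW hres using hex
    obtain ⟨t, htE, htc, hcov⟩ := TopologicalSpace.countable_cover_nhdsWithin hW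
    have h1 : ∀ᶠ h in residual C(X, unitInterval), ∀ p ∈ t,
        ∀ q ∈ W p, delayMap T h (2 * d + 1) q.1 ≠ delayMap T h (2 * d + 1) q.2 :=
      (eventually_countable_ball htc).2 fun p hp => hres p (htE hp)
    filter_upwards [h1] with h hh q hq
    obtain ⟨p, hp, hqp⟩ := mem_iUnion₂.1 (hcov hq)
    exact hh p hp q hqp
  filter_upwards [eventually_countable_forall.2 fun n => eventually_countable_forall.2 (key n)]
    with h hh
  intro x y hxy
  by_contra hne
  obtain ⟨n, hn, hnd, hx⟩ := exists_mem_orbitStratum T (4 * d) x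
  obtain ⟨m, hm, hmd, hy⟩ := exists_mem_orbitStratum T (4 * d) y
  exact hh n m (x, y) ⟨hn, hnd, hm, hmd, hx, hy, hne⟩ hxy

end

end Takens

theorem theorem1 {X : Type*} [MetricSpace X] [CompactSpace X] (T : X → X)
    (hTc : Continuous T) (hTi : Function.Injective T) (d : ℕ)
    (hd : Takens.coveringDim X = (d : WithBot ℕ∞))
    (hP : ∀ n : ℕ, 1 ≤ n → n ≤ 2 * d →
      2 * Takens.coveringDim (Takens.periodicPtsLE T n) < (n : WithBot ℕ∞)) :
    {h : C(X, unitInterval) | IsEmbedding (Takens.delayMap T h (2 * d + 1))} ∈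
      residual C(X, unitInterval) := by
  filter_upwards [Takens.eventually_residual_injective hTc hTi hd hP] with h hh
  have hcont : Continuous (Takens.delayMap T h (2 * d + 1)) :=
    continuous_pi fun k => h.continuous.comp (hTc.iterate k)
  exact (hcont.isClosedEmbedding hh).isEmbedding
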